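/- For each $n\ge 1$ let $X_1,\dots,X_n$ be independent random variables, each with the normal distribution $N(\mu,\sigma^2)$, where $\mu\in\mathbb{R}$ and $\sigma>0$ do not depend on $n$ (the samples for different $n$ may, but need not, be initial segments of one infinite sequence). For a finite real sample let $\operatorname{median}$ denote the sample median (the middle order statistic if the sample size is odd, the mean of the two middle order statistics if it is even), and let $\Phi^{-1}(p)=\inf\{t\in\mathbb{R}:p\le\Phi(t)\}$ be the quantile function of the standard normal distribution, with distribution function $\Phi$. Then, as $n\to\infty$, $$\sqrt{\frac{2n}{\pi}}\;\Phi^{-1}\!\Big(\frac34\Big)\cdot\frac{\operatorname{median}_{1\le i\le n}X_i-\mu}{\operatorname{median}_{1\le i\le n}\big|X_i-\operatorname{median}_{1\le j\le n}X_j\big|}\;\xrightarrow{\;d\;}\;N(0,1).$$ -/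

import Mathlib

open MeasureTheory ProbabilityTheory Filter
open scoped NNReal

noncomputable section

/-- The `k`-th smallest entry (counted from `0`, with multiplicity) of a finite real sample. -/
def orderStatistic {n : ℕ} (x : Fin n → ℝ) (k : Fin n) : ℝ :=
  x (Tuple.sort x k)

/-- The sample median: the middle order statistic if the sample size `n` is odd, the mean of the two
middle order statistics if `n` is even (and, by convention, `0` for the empty sample). -/
def sampleMedian {n : ℕ} (x : Fin n → ℝ) : ℝ :=
  if h : 0 < n then
    (orderStatistic x ⟨(n - 1) / 2, by omega⟩ + orderStatistic x ⟨n / 2, by omega⟩) / 2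
  else 0

/-- The (unscaled) median absolute deviation of a sample from its median. -/
def sampleMAD {n : ℕ} (x : Fin n → ℝ) : ℝ :=
  sampleMedian fun i => |x i - sampleMedian x|

/-- The quantile function `p ↦ inf {t | p ≤ F t}` of a probability measure on `ℝ` with cumulative
distribution function `F`. -/
def quantile (ν : Measure ℝ) (p : ℝ) : ℝ :=
  sInf {t : ℝ | p ≤ cdf ν t}

end

/-!
The statistic is the product of two factors, treated separately and recombined by Slutsky's theorem:
after standardizing, `√(2n/π) · median` converges in distribution to `N(0, 1)`, and
`Φ⁻¹(3/4) / MAD` converges to `1` almost surely.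

Both halves rest on the counting description of order statistics (`orderStatistic_le_iff`): up to
ties at exactly one half, `median ≤ t` says that at least half of the observations are at most `t`.

* Consistency (`ae_tendsto_sampleMedian`, `ae_tendsto_sampleMAD`). By the strong law of large
  numbers the empirical frequencies of `(-∞, r]` and `[-r, r]` converge for all rational `r`. The
  first gives `median → 0`; the second, together with `median → 0`, shows that the MAD converges to
  the median of `|Z|`, which is `Φ⁻¹(3/4)` since `P(|Z| ≤ r) = 2 Φ(r) - 1`.
* Asymptotic normality (`tendstoInDistribution_sampleMedian`). For `a = s / (c √n)` the probability
  of `median ≤ a` is squeezed between the probabilities that `V > 0` and that `V ≥ 0`, where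
  `V = (2 #{i | Z i ≤ a} - n) / √n`. Here `V` is the sum of the normalized sum of the random signs
  `±1` attached to `Z i ≤ 0` and `Z i > 0` (the central limit theorem), of a fluctuation of variance
  at most `4 |F(a) - F(0)| → 0` (Chebyshev), and of the drift `2 √n (F(a) - F(0)) → s`. So
  `V` converges to `N(s, 1)`, and the limiting probability is `Φ(s)`. For the normal distribution
  `c = 2 φ(0) = √(2/π)`.

Slutsky's theorem, as used here, needs all samples to live on one probability space. As only laws
matter, the samples may be replaced by initial segments of one i.i.d. sequence
(`TendstoInDistribution.of_infinitePi`).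
-/

open scoped Topology

/-! ### Order statistics, medians and counts -/

/-- The counting description of order statistics; everything about the sample median below is
derived from it. -/
lemma orderStatistic_le_iff {n : ℕ} (x : Fin n → ℝ) (k : Fin n) (t : ℝ) :
    orderStatistic x k ≤ t ↔ (k : ℕ) < Finset.card {i | x i ≤ t} := by
  have h := Tuple.lt_card_le_iff_apply_le_of_monotone (j := k) (a := t) (Tuple.monotone_sort x)
  have hcard : Finset.card {i | (x ∘ Tuple.sort x) i ≤ t} = Finset.card {i | x i ≤ t} :=
    Finset.card_equiv (Tuple.sort x) (by simp)
  rw [hcard] at h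
  exact h.symm

lemma orderStatistic_mono {n : ℕ} (x : Fin n → ℝ) : Monotone (orderStatistic x) :=
  Tuple.monotone_sort x

lemma sampleMedian_le_of_lt_card {n : ℕ} {x : Fin n → ℝ} {t : ℝ}
    (h : n < 2 * Finset.card {i | x i ≤ t}) : sampleMedian x ≤ t := by
  have hn : 0 < n := by
    rcases Nat.eq_zero_or_pos n with rfl | hn
    · simp at h
    · exact hn
  rw [sampleMedian, dif_pos hn]
  have h1 : orderStatistic x ⟨n / 2, by omega⟩ ≤ t :=
    (orderStatistic_le_iff ..).2 (by simp only; omega)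
  have h2 : orderStatistic x ⟨(n - 1) / 2, by omega⟩ ≤ orderStatistic x ⟨n / 2, by omega⟩ :=
    orderStatistic_mono x (Fin.mk_le_mk.2 (by omega))
  linarith

lemma le_card_of_sampleMedian_le {n : ℕ} {x : Fin n → ℝ} {t : ℝ}
    (h : sampleMedian x ≤ t) : n ≤ 2 * Finset.card {i | x i ≤ t} := by
  rcases Nat.eq_zero_or_pos n with rfl | hn
  · simp
  rw [sampleMedian, dif_pos hn] at h
  have h2 : orderStatistic x ⟨(n - 1) / 2, by omega⟩ ≤ orderStatistic x ⟨n / 2, by omega⟩ :=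
    orderStatistic_mono x (Fin.mk_le_mk.2 (by omega))
  have h1 : orderStatistic x ⟨(n - 1) / 2, by omega⟩ ≤ t := by linarith
  have h3 := (orderStatistic_le_iff ..).1 h1
  simp only at h3
  omega

lemma orderStatistic_add_mul {n : ℕ} (a : ℝ) {b : ℝ} (hb : 0 < b) (x : Fin n → ℝ) (k : Fin n) :
    orderStatistic (fun i => a + b * x i) k = a + b * orderStatistic x k := by
  refine eq_of_forall_ge_iff fun t => ?_
  have h (y : ℝ) : a + b * y ≤ t ↔ y ≤ (t - a) / b := by
    rw [le_div_iff₀ hb]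
    constructor <;> intro <;> linarith
  rw [orderStatistic_le_iff, h, orderStatistic_le_iff]
  simp only [h]

/-- The sample median is equivariant under increasing affine maps (except for the empty sample,
whose median is `0` by convention). -/
lemma sampleMedian_add_mul {n : ℕ} (hn : 0 < n) (a : ℝ) {b : ℝ} (hb : 0 < b) (x : Fin n → ℝ) :
    sampleMedian (fun i => a + b * x i) = a + b * sampleMedian x := by
  simp only [sampleMedian, dif_pos hn, orderStatistic_add_mul a hb]
  ring

lemma sampleMAD_add_mul {n : ℕ} (hn : 0 < n) (a : ℝ) {b : ℝ} (hb : 0 < b) (x : Fin n → ℝ) :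
    sampleMAD (fun i => a + b * x i) = b * sampleMAD x := by
  have h (i : Fin n) : |a + b * x i - (a + b * sampleMedian x)| =
      0 + b * |x i - sampleMedian x| := by
    rw [zero_add, ← abs_of_pos hb, ← abs_mul, abs_of_pos hb]
    ring_nf
  simp only [sampleMAD, sampleMedian_add_mul hn a hb, h]
  rw [sampleMedian_add_mul hn 0 hb, zero_add]

lemma measurable_orderStatistic {n : ℕ} (k : Fin n) :
    Measurable fun x : Fin n → ℝ => orderStatistic x k := by
  refine measurable_of_Iic fun t => ?_
  have h : (fun x : Fin n → ℝ => orderStatistic x k) ⁻¹' Set.Iic t =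
      {x | (k : ℕ) < ∑ i, if x i ≤ t then 1 else 0} := by
    ext x
    simp [orderStatistic_le_iff]
  rw [h]
  refine measurableSet_lt measurable_const (Finset.measurable_sum _ fun i _ => ?_)
  exact Measurable.ite (measurableSet_le (measurable_pi_apply i) measurable_const)
    measurable_const measurable_const

lemma measurable_sampleMedian (n : ℕ) : Measurable (sampleMedian (n := n)) := by
  by_cases hn : 0 < n
  · have h : sampleMedian (n := n) = fun x => (orderStatistic x ⟨(n - 1) / 2, by omega⟩ +
        orderStatistic x ⟨n / 2, by omega⟩) / 2 := by
      funext x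
      rw [sampleMedian, dif_pos hn]
    rw [h]
    exact ((measurable_orderStatistic _).add (measurable_orderStatistic _)).div_const 2
  · have h : sampleMedian (n := n) = fun _ => 0 := by
      funext x
      rw [sampleMedian, dif_neg hn]
    rw [h]
    exact measurable_const

lemma measurable_sampleMAD (n : ℕ) : Measurable (sampleMAD (n := n)) := by
  refine (measurable_sampleMedian n).comp (measurable_pi_iff.2 fun i => ?_)
  exact ((measurable_pi_apply i).sub (measurable_sampleMedian n)).abs

/-- Consistency criterion: sample medians converge to `q` as soon as, for every `ε > 0`, eventually
more than half of the observations are at most `q + ε` and fewer than half are at most `q - ε`. -/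
lemma tendsto_sampleMedian {x : (n : ℕ) → Fin n → ℝ} {q : ℝ}
    (hle : ∀ ε > 0, ∀ᶠ n : ℕ in atTop, n < 2 * Finset.card {i | x n i ≤ q + ε})
    (hgt : ∀ ε > 0, ∀ᶠ n : ℕ in atTop, 2 * Finset.card {i | x n i ≤ q - ε} < n) :
    Tendsto (fun n => sampleMedian (x n)) atTop (𝓝 q) := by
  refine tendsto_order.2 ⟨fun a ha => ?_, fun a ha => ?_⟩
  · filter_upwards [hgt (q - a) (by linarith)] with n hn
    by_contra! h
    rw [sub_sub_cancel] at hn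
    exact absurd (le_card_of_sampleMedian_le h) (by omega)
  · filter_upwards [hle ((a - q) / 2) (by linarith)] with n hn
    exact (sampleMedian_le_of_lt_card hn).trans_lt (by linarith)

/-! ### Weak convergence on the line and the standard normal distribution -/

lemma measureReal_Ioc_eq_sub (μ : Measure ℝ) [IsFiniteMeasure μ] {a b : ℝ} (hab : a ≤ b) :
    μ.real (Set.Ioc a b) = μ.real (Set.Iic b) - μ.real (Set.Iic a) := by
  have h : Set.Ioc a b = Set.Iic b \ Set.Iic a := by
    ext x
    simp [and_comm]
  rw [h, measureReal_sdiff (Set.Iic_subset_Iic.2 hab) measurableSet_Iic]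

lemma tendsto_probabilityMeasure_of_tendsto_measureReal_Iic {μ : ℕ → ProbabilityMeasure ℝ}
    {ν : ProbabilityMeasure ℝ}
    (h : ∀ t, Tendsto (fun n => (μ n : Measure ℝ).real (Set.Iic t)) atTop
      (𝓝 ((ν : Measure ℝ).real (Set.Iic t)))) :
    Tendsto μ atTop (𝓝 ν) := by
  have hIoc (κ : ProbabilityMeasure ℝ) {a b : ℝ} (hab : a ≤ b) :
      ((κ (Set.Ioc a b) : ℝ≥0) : ℝ) =
        (κ : Measure ℝ).real (Set.Iic b) - (κ : Measure ℝ).real (Set.Iic a) :=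
    measureReal_Ioc_eq_sub κ hab
  have hS : IsPiSystem {s : Set ℝ | ∃ a b, a ≤ b ∧ s = Set.Ioc a b} := by
    rintro _ ⟨a, b, -, rfl⟩ _ ⟨c, d, -, rfl⟩ hne
    rw [Set.Ioc_inter_Ioc] at hne ⊢
    exact ⟨_, _, (Set.nonempty_Ioc.1 hne).le, rfl⟩
  refine hS.tendsto_probabilityMeasure_of_tendsto_of_mem ?_ ?_ ?_
  · rintro _ ⟨a, b, -, rfl⟩
    exact measurableSet_Ioc
  · intro u hu x hx
    obtain ⟨ε, hε, hsub⟩ := Metric.isOpen_iff.1 hu x hx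
    refine ⟨Set.Ioc (x - ε / 2) (x + ε / 2), ⟨_, _, by linarith, rfl⟩,
      Ioc_mem_nhds (by linarith) (by linarith), fun y hy => hsub ?_⟩
    rw [Metric.mem_ball, Real.dist_eq, abs_lt]
    constructor <;> linarith [hy.1, hy.2]
  · rintro _ ⟨a, b, hab, rfl⟩
    rw [← NNReal.tendsto_coe]
    simp only [hIoc _ hab]
    exact (h b).sub (h a)

instance instNullSingletonClassGaussianRealZeroOne :
    NullSingletonClass (gaussianReal 0 1) :=
  nullSingletonClass_gaussianReal one_ne_zero

lemma gaussianReal_measureReal_Iic_neg (t : ℝ) :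
    (gaussianReal 0 1).real (Set.Iic (-t)) = 1 - (gaussianReal 0 1).real (Set.Iic t) := by
  have h1 : (gaussianReal 0 1).map (fun x => -x) = gaussianReal 0 1 := by
    rw [gaussianReal_map_neg, neg_zero]
  rw [← probReal_compl_eq_one_sub measurableSet_Iic, Set.compl_Iic,
    ← measureReal_congr Ioi_ae_eq_Ici.symm]
  conv_lhs => rw [← h1, map_measureReal_apply measurable_neg measurableSet_Iic]
  simp

lemma gaussianReal_measureReal_Iic_zero : (gaussianReal 0 1).real (Set.Iic 0) = 1 / 2 := by
  have h := gaussianReal_measureReal_Iic_neg 0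
  rw [neg_zero] at h
  linarith

lemma gaussianReal_measureReal_Icc_neg {r : ℝ} (hr : 0 ≤ r) :
    (gaussianReal 0 1).real (Set.Icc (-r) r) = 2 * (gaussianReal 0 1).real (Set.Iic r) - 1 := by
  have h : (gaussianReal 0 1).real (Set.Icc (-r) r) = (gaussianReal 0 1).real (Set.Ioc (-r) r) :=
    measureReal_congr Ioc_ae_eq_Icc.symm
  rw [h, measureReal_Ioc_eq_sub _ (by linarith), gaussianReal_measureReal_Iic_neg]
  ring

lemma strictMono_gaussianReal_measureReal_Iic :
    StrictMono fun t => (gaussianReal 0 1).real (Set.Iic t) := by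
  intro a b hab
  have h : 0 < (gaussianReal 0 1).real (Set.Ioc a b) := by
    refine ENNReal.toReal_pos (fun h0 => ?_) (measure_ne_top _ _)
    have := gaussianReal_absolutelyContinuous' 0 one_ne_zero h0
    simp at this
    linarith
  rw [measureReal_Ioc_eq_sub _ hab.le] at h
  simpa using h

/-- The density of `N(0, 1)` at its median is `1 / √(2π)`. -/
lemma hasDerivAt_gaussianReal_measureReal_Iic_zero :
    HasDerivAt (fun t => (gaussianReal 0 1).real (Set.Iic t)) (√(2 * Real.pi))⁻¹ 0 := by
  have hF (t : ℝ) : (gaussianReal 0 1).real (Set.Iic t) =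
      (gaussianReal 0 1).real (Set.Iic 0) + ∫ x in (0 : ℝ)..t, gaussianPDFReal 0 1 x := by
    have h (s : ℝ) : (gaussianReal 0 1).real (Set.Iic s) =
        ∫ x in Set.Iic s, gaussianPDFReal 0 1 x := by
      rw [measureReal_def, gaussianReal_apply_eq_integral 0 one_ne_zero, ENNReal.toReal_ofReal]
      exact integral_nonneg fun x => gaussianPDFReal_nonneg 0 1 x
    rw [h, h, ← intervalIntegral.integral_Iic_sub_Iic]
    · ring
    · exact (integrable_gaussianPDFReal 0 1).integrableOn
    · exact (integrable_gaussianPDFReal 0 1).integrableOn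
  have hcont : Continuous (gaussianPDFReal 0 1) := by
    rw [gaussianPDFReal_def]
    fun_prop
  have h0 : gaussianPDFReal 0 1 0 = (√(2 * Real.pi))⁻¹ := by simp [gaussianPDFReal]
  rw [← h0, funext hF]
  exact (hcont.integral_hasStrictDerivAt 0 0).hasDerivAt.const_add _

lemma gaussianReal_measureReal_Iic_lt_of_lt_quantile {r : ℝ}
    (hr : r < quantile (gaussianReal 0 1) (3 / 4)) :
    (gaussianReal 0 1).real (Set.Iic r) < 3 / 4 := by
  by_contra! h
  refine hr.not_ge (csInf_le ⟨0, fun t ht => ?_⟩ (by simpa [cdf_eq_real] using h))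
  simp only [Set.mem_ofPred_eq, cdf_eq_real] at ht
  refine (strictMono_gaussianReal_measureReal_Iic.le_iff_le).1 ?_
  simp only [gaussianReal_measureReal_Iic_zero]
  linarith

lemma lt_gaussianReal_measureReal_Iic_of_quantile_lt {r : ℝ}
    (hr : quantile (gaussianReal 0 1) (3 / 4) < r) :
    3 / 4 < (gaussianReal 0 1).real (Set.Iic r) := by
  have hne : {t : ℝ | 3 / 4 ≤ cdf (gaussianReal 0 1) t}.Nonempty :=
    ((tendsto_cdf_atTop (gaussianReal 0 1)).eventually_const_le (by norm_num)).exists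
  obtain ⟨t, ht, htr⟩ := exists_lt_of_csInf_lt hne hr
  rw [Set.mem_ofPred_eq, cdf_eq_real] at ht
  exact ht.trans_lt (strictMono_gaussianReal_measureReal_Iic htr)

lemma quantile_gaussianReal_pos : 0 < quantile (gaussianReal 0 1) (3 / 4) := by
  have hc : ContinuousAt (fun t => (gaussianReal 0 1).real (Set.Iic t)) 0 :=
    hasDerivAt_gaussianReal_measureReal_Iic_zero.continuousAt
  have hlt : (gaussianReal 0 1).real (Set.Iic 0) < 3 / 4 := by
    rw [gaussianReal_measureReal_Iic_zero]
    norm_num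
  obtain ⟨ε, hε, hball⟩ := Metric.eventually_nhds_iff.1 (hc.eventually_lt_const hlt)
  by_contra! h
  have h1 := hball (y := ε / 2) (by rw [Real.dist_eq, abs_lt]; constructor <;> linarith)
  exact absurd h1 (lt_gaussianReal_measureReal_Iic_of_quantile_lt (by linarith)).not_gt

/-- `Φ⁻¹(3/4)` is the median of `|Z|` for `Z ∼ N(0, 1)`: the upper side. -/
lemma half_lt_gaussianReal_Icc {r : ℝ} (hr : quantile (gaussianReal 0 1) (3 / 4) < r) :
    1 / 2 < (gaussianReal 0 1).real (Set.Icc (-r) r) := by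
  rw [gaussianReal_measureReal_Icc_neg (quantile_gaussianReal_pos.trans hr).le]
  linarith [lt_gaussianReal_measureReal_Iic_of_quantile_lt hr]

/-- `Φ⁻¹(3/4)` is the median of `|Z|` for `Z ∼ N(0, 1)`: the lower side. -/
lemma gaussianReal_Icc_lt_half {r : ℝ} (hr : r < quantile (gaussianReal 0 1) (3 / 4)) :
    (gaussianReal 0 1).real (Set.Icc (-r) r) < 1 / 2 := by
  rcases lt_or_ge r 0 with h | h
  · rw [Set.Icc_eq_empty (by linarith), measureReal_empty]
    norm_num
  · rw [gaussianReal_measureReal_Icc_neg h]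
    linarith [gaussianReal_measureReal_Iic_lt_of_lt_quantile hr]

/-! ### Consistency of the median and of the median absolute deviation -/

lemma sum_range_indicator_eq_card {α : Type*} (z : ℕ → α) (p : α → Prop) [DecidablePred p] (n : ℕ) :
    ∑ i ∈ Finset.range n, {x | p x}.indicator (fun _ => (1 : ℝ)) (z i) =
      Finset.card {i : Fin n | p (z i)} := by
  rw [← Fin.sum_univ_eq_sum_range (fun i => {x | p x}.indicator (fun _ => (1 : ℝ)) (z i)) n,
    Finset.card_filter]
  push_cast
  exact Finset.sum_congr rfl fun i _ => by simp [Set.indicator_apply]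

lemma eventually_lt_two_mul_of_tendsto_div {c : ℕ → ℕ} {p : ℝ}
    (h : Tendsto (fun n : ℕ => (c n : ℝ) / n) atTop (𝓝 p)) (hp : 1 / 2 < p) :
    ∀ᶠ n : ℕ in atTop, n < 2 * c n := by
  filter_upwards [h.eventually_const_lt hp, eventually_gt_atTop 0] with n hn hpos
  rw [lt_div_iff₀ (by positivity)] at hn
  exact_mod_cast (by linarith : (n : ℝ) < 2 * c n)

lemma eventually_two_mul_lt_of_tendsto_div {c : ℕ → ℕ} {p : ℝ}
    (h : Tendsto (fun n : ℕ => (c n : ℝ) / n) atTop (𝓝 p)) (hp : p < 1 / 2) :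
    ∀ᶠ n : ℕ in atTop, 2 * c n < n := by
  filter_upwards [h.eventually_lt_const hp, eventually_gt_atTop 0] with n hn hpos
  rw [div_lt_iff₀ (by positivity)] at hn
  exact_mod_cast (by linarith : 2 * (c n : ℝ) < n)

section IID

variable {Ω : Type*} [MeasurableSpace Ω] {P : Measure Ω}
  {ν : Measure ℝ} {Z : ℕ → Ω → ℝ}

lemma HasLaw.integral_indicator_comp {Y : Ω → ℝ} (hY : HasLaw Y ν P) {B : Set ℝ}
    (hB : MeasurableSet B) : ∫ ω, B.indicator (fun _ => (1 : ℝ)) (Y ω) ∂P = ν.real B := by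
  have h := hY.integral_comp (f := B.indicator fun _ => (1 : ℝ))
    (measurable_const.indicator hB).aestronglyMeasurable
  rw [integral_indicator_const _ hB, smul_eq_mul, mul_one] at h
  exact h

variable [IsProbabilityMeasure P]

/-- The strong law of large numbers for empirical frequencies. -/
lemma ae_tendsto_card_div (hindep : iIndepFun Z P) (hlaw : ∀ i, HasLaw (Z i) ν P) (p : ℝ → Prop)
    [DecidablePred p] (hp : MeasurableSet {x | p x}) :
    ∀ᵐ ω ∂P, Tendsto (fun n : ℕ => (Finset.card {i : Fin n | p (Z i ω)} : ℝ) / n) atTop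
      (𝓝 (ν.real {x | p x})) := by
  have hg : Measurable ({x | p x}.indicator fun _ => (1 : ℝ)) := measurable_const.indicator hp
  have hZ i := (hlaw i).aemeasurable
  have h := strong_law_ae_real (μ := P) (fun i ω => {x | p x}.indicator (fun _ => (1 : ℝ)) (Z i ω))
    (.of_bound (hg.comp_aemeasurable (hZ 0)).aestronglyMeasurable 1
      (ae_of_all _ fun ω => (norm_indicator_le_norm_self _ _).trans (by simp)))
    (fun i j hij => (hindep.indepFun hij).comp hg hg)
    (fun i => ((hlaw i).identDistrib (hlaw 0)).comp hg)
  filter_upwards [h] with ω hω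
  rw [HasLaw.integral_indicator_comp (hlaw 0) hp] at hω
  simpa only [sum_range_indicator_eq_card (fun i => Z i ω)] using hω

/-- Sample medians are strongly consistent if `0` is the only median of the common law `ν`. -/
lemma ae_tendsto_sampleMedian (hindep : iIndepFun Z P) (hlaw : ∀ i, HasLaw (Z i) ν P)
    (hgt : ∀ ε > 0, 1 / 2 < ν.real (Set.Iic ε)) (hlt : ∀ ε > 0, ν.real (Set.Iic (-ε)) < 1 / 2) :
    ∀ᵐ ω ∂P, Tendsto (fun n : ℕ => sampleMedian fun i : Fin n => Z i ω) atTop (𝓝 0) := by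
  have h : ∀ᵐ ω ∂P, ∀ r : ℚ, Tendsto
      (fun n : ℕ => (Finset.card {i : Fin n | Z i ω ≤ (r : ℝ)} : ℝ) / n) atTop
      (𝓝 (ν.real (Set.Iic (r : ℝ)))) :=
    ae_all_iff.2 fun r => ae_tendsto_card_div hindep hlaw (· ≤ (r : ℝ)) measurableSet_Iic
  filter_upwards [h] with ω hω
  refine tendsto_sampleMedian (fun ε hε => ?_) (fun ε hε => ?_)
  · obtain ⟨r, hr0, hrε⟩ := exists_rat_btwn hε
    filter_upwards [eventually_lt_two_mul_of_tendsto_div (hω r) (hgt r hr0)] with n hn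
    refine hn.trans_le (Nat.mul_le_mul_left 2 (Finset.card_le_card fun i hi => ?_))
    simp only [Finset.mem_filter, Finset.mem_univ, true_and] at hi ⊢
    linarith
  · obtain ⟨r, hrε, hr0⟩ := exists_rat_btwn (neg_lt_zero.2 hε)
    have hr : ν.real (Set.Iic (r : ℝ)) < 1 / 2 := by
      have := hlt (-r) (by linarith)
      rwa [neg_neg] at this
    filter_upwards [eventually_two_mul_lt_of_tendsto_div (hω r) hr] with n hn
    refine (Nat.mul_le_mul_left 2 (Finset.card_le_card fun i hi => ?_)).trans_lt hn
    simp only [Finset.mem_filter, Finset.mem_univ, true_and] at hi ⊢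
    linarith

/-- Strong consistency of the median absolute deviation. Since the sample medians tend to `0`,
centring at them moves the observations by a vanishing amount, so that eventually
`{|x| ≤ r}` and `{|x - med| ≤ r ± ε}` can be compared. -/
lemma ae_tendsto_sampleMAD (hindep : iIndepFun Z P) (hlaw : ∀ i, HasLaw (Z i) ν P) {q : ℝ}
    (hmed : ∀ᵐ ω ∂P, Tendsto (fun n : ℕ => sampleMedian fun i : Fin n => Z i ω) atTop (𝓝 0))
    (hgt : ∀ r > q, 1 / 2 < ν.real (Set.Icc (-r) r))
    (hlt : ∀ r < q, ν.real (Set.Icc (-r) r) < 1 / 2) :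
    ∀ᵐ ω ∂P, Tendsto (fun n : ℕ => sampleMAD fun i : Fin n => Z i ω) atTop (𝓝 q) := by
  have h : ∀ᵐ ω ∂P, ∀ r : ℚ, Tendsto
      (fun n : ℕ => (Finset.card {i : Fin n | -(r : ℝ) ≤ Z i ω ∧ Z i ω ≤ r} : ℝ) / n) atTop
      (𝓝 (ν.real (Set.Icc (-(r : ℝ)) r))) :=
    ae_all_iff.2 fun r => ae_tendsto_card_div hindep hlaw (fun x => -(r : ℝ) ≤ x ∧ x ≤ r)
      measurableSet_Icc
  filter_upwards [h, hmed] with ω hω hm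
  have hm' {δ : ℝ} (hδ : 0 < δ) :
      ∀ᶠ n : ℕ in atTop, |sampleMedian fun i : Fin n => Z i ω| < δ := by
    simpa [Real.dist_eq] using Metric.tendsto_nhds.1 hm δ hδ
  refine tendsto_sampleMedian (fun ε hε => ?_) (fun ε hε => ?_)
  · obtain ⟨r, hqr, hrε⟩ := exists_rat_btwn (lt_add_of_pos_right q hε)
    filter_upwards [eventually_lt_two_mul_of_tendsto_div (hω r) (hgt r hqr),
      hm' (sub_pos.2 hrε)] with n hn hmn
    refine hn.trans_le (Nat.mul_le_mul_left 2 (Finset.card_le_card fun i hi => ?_))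
    simp only [Finset.mem_filter, Finset.mem_univ, true_and] at hi ⊢
    rw [abs_lt] at hmn
    rw [abs_le]
    constructor <;> linarith [hi.1, hi.2]
  · obtain ⟨r, hrε, hqr⟩ := exists_rat_btwn (sub_lt_self q hε)
    filter_upwards [eventually_two_mul_lt_of_tendsto_div (hω r) (hlt r hqr),
      hm' (sub_pos.2 hrε)] with n hn hmn
    refine (Nat.mul_le_mul_left 2 (Finset.card_le_card fun i hi => ?_)).trans_lt hn
    simp only [Finset.mem_filter, Finset.mem_univ, true_and] at hi ⊢
    rw [abs_lt] at hmn
    rw [abs_le] at hi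
    constructor <;> linarith [hi.1, hi.2]

/-! ### Asymptotic normality of the median -/

/-- Chebyshev's inequality for a triangular array: normalized centred sums of `g n (Z i)` vanish in
probability when the second moments of `g n` tend to `0`. -/
lemma tendstoInMeasure_inv_sqrt_mul_sum_sub (hindep : iIndepFun Z P)
    (hlaw : ∀ i, HasLaw (Z i) ν P) {g : ℕ → ℝ → ℝ} (hg : ∀ n, Measurable (g n)) {C : ℝ}
    (hC : ∀ n x, ‖g n x‖ ≤ C) (h2 : Tendsto (fun n => ∫ x, g n x ^ 2 ∂ν) atTop (𝓝 0)) :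
    TendstoInMeasure P (fun (n : ℕ) ω =>
      (√n)⁻¹ * ∑ i ∈ Finset.range n, (g n (Z i ω) - ∫ x, g n x ∂ν)) atTop 0 := by
  have hmem (n i : ℕ) : MemLp (fun ω => g n (Z i ω)) 2 P :=
    .of_bound ((hg n).comp_aemeasurable (hlaw i).aemeasurable).aestronglyMeasurable C
      (ae_of_all _ fun ω => hC n _)
  rw [tendstoInMeasure_iff_norm]
  intro ε hε
  have hlim : Tendsto (fun n => ENNReal.ofReal ((∫ x, g n x ^ 2 ∂ν) / ε ^ 2)) atTop (𝓝 0) := by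
    simpa using ENNReal.tendsto_ofReal (h2.div_const (ε ^ 2))
  refine tendsto_of_tendsto_of_tendsto_of_le_of_le' tendsto_const_nhds hlim
    (Eventually.of_forall fun _ => zero_le) ?_
  filter_upwards [eventually_gt_atTop 0] with n hn
  have hs : 0 < √(n : ℝ) := Real.sqrt_pos.2 (by exact_mod_cast hn)
  set Y : Ω → ℝ := ∑ i ∈ Finset.range n, fun ω => g n (Z i ω) with hY
  have hYmem : MemLp Y 2 P := memLp_finsetSum' _ fun i _ => hmem n i
  have hmean (i : ℕ) : ∫ ω, g n (Z i ω) ∂P = ∫ x, g n x ∂ν :=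
    (hlaw i).integral_comp (hg n).aestronglyMeasurable
  have hEY : P[Y] = n * ∫ x, g n x ∂ν := by
    simp only [hY, Finset.sum_apply]
    rw [integral_finsetSum _ fun i _ => (hmem n i).integrable one_le_two]
    simp [hmean]
  have hvar : Var[Y; P] ≤ n * ∫ x, g n x ^ 2 ∂ν := by
    rw [hY, IndepFun.variance_sum (fun i _ => hmem n i)
      (fun i _ j _ hij => (hindep.indepFun hij).comp (hg n) (hg n))]
    have hle (i : ℕ) : Var[fun ω => g n (Z i ω); P] ≤ ∫ x, g n x ^ 2 ∂ν := by
      refine (variance_le_expectation_sq (hmem n i).aestronglyMeasurable).trans_eq ?_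
      exact (hlaw i).integral_comp ((hg n).pow_const 2).aestronglyMeasurable
    refine (Finset.sum_le_sum fun i _ => hle i).trans_eq ?_
    simp
  have hset : {ω | ε ≤ ‖(√n)⁻¹ * ∑ i ∈ Finset.range n, (g n (Z i ω) - ∫ x, g n x ∂ν) -
      (0 : Ω → ℝ) ω‖} = {ω | √n * ε ≤ |Y ω - P[Y]|} := by
    ext ω
    have : ∑ i ∈ Finset.range n, (g n (Z i ω) - ∫ x, g n x ∂ν) = Y ω - P[Y] := by
      rw [hEY]
      simp [hY, Finset.sum_apply]
    simp only [Set.mem_ofPred_eq, this, Pi.zero_apply, sub_zero, norm_mul, norm_inv,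
      Real.norm_eq_abs, abs_of_pos hs]
    rw [le_inv_mul_iff₀ hs]
  rw [hset]
  refine (meas_ge_le_variance_div_sq hYmem (mul_pos hs hε)).trans (ENNReal.ofReal_le_ofReal ?_)
  rw [mul_pow, Real.sq_sqrt (Nat.cast_nonneg n), div_le_div_iff₀ (by positivity) (by positivity)]
  nlinarith [sq_nonneg ε, mul_le_mul_of_nonneg_right hvar (sq_nonneg ε)]

/-- The difference of the two indicators has constant sign and values in `{-1, 0, 1}`, so its square
is its absolute value. -/
lemma integral_indicator_sub_indicator_sq [IsProbabilityMeasure ν] (a : ℝ) :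
    ∫ x, ((Set.Iic a).indicator (fun _ => (1 : ℝ)) x -
      (Set.Iic (0 : ℝ)).indicator (fun _ => (1 : ℝ)) x) ^ 2 ∂ν =
      |ν.real (Set.Iic a) - ν.real (Set.Iic 0)| := by
  have hint (c : ℝ) : Integrable ((Set.Iic c).indicator fun _ => (1 : ℝ)) ν :=
    (integrable_const 1).indicator measurableSet_Iic
  have hval (b c : ℝ) : ∫ x, ((Set.Iic b).indicator (fun _ => (1 : ℝ)) x -
      (Set.Iic c).indicator (fun _ => (1 : ℝ)) x) ∂ν =
      ν.real (Set.Iic b) - ν.real (Set.Iic c) := by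
    rw [integral_sub (hint b) (hint c), integral_indicator_const _ measurableSet_Iic,
      integral_indicator_const _ measurableSet_Iic]
    simp
  rcases le_total a 0 with h | h
  · rw [abs_of_nonpos (sub_nonpos.2 (measureReal_mono (Set.Iic_subset_Iic.2 h))), neg_sub,
      ← hval]
    refine integral_congr_ae (ae_of_all _ fun x => ?_)
    by_cases h1 : x ≤ a
    · simp [h1, h1.trans h]
    · by_cases h2 : x ≤ 0 <;> simp [h1, h2]
  · rw [abs_of_nonneg (sub_nonneg.2 (measureReal_mono (Set.Iic_subset_Iic.2 h))), ← hval]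
    refine integral_congr_ae (ae_of_all _ fun x => ?_)
    by_cases h1 : x ≤ 0
    · simp [h1, h1.trans h]
    · by_cases h2 : x ≤ a <;> simp [h1, h2]

/-- Empirical counts at a moving threshold `a n` with `F(a n) → F(0) = 1/2`. The sum splits into the
sum at the threshold `0`, to which the central limit theorem applies, a fluctuation between the thresholds `0`
and `a n`, which vanishes in probability, and the deterministic drift `2√n (F(a n) - 1/2)`. -/
lemma tendstoInDistribution_card_Iic [IsProbabilityMeasure ν] (hindep : iIndepFun Z P)
    (hlaw : ∀ i, HasLaw (Z i) ν P) (h0 : ν.real (Set.Iic 0) = 1 / 2) {a : ℕ → ℝ} {s : ℝ}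
    (ha : Tendsto (fun n => ν.real (Set.Iic (a n))) atTop (𝓝 (1 / 2)))
    (hdrift : Tendsto (fun n : ℕ => 2 * √n * (ν.real (Set.Iic (a n)) - 1 / 2)) atTop (𝓝 s)) :
    TendstoInDistribution
      (fun (n : ℕ) ω => (√n)⁻¹ * (2 * (Finset.card {i : Fin n | Z i ω ≤ a n} : ℝ) - n))
      atTop (fun x : ℝ => x + s) (fun _ => P) (gaussianReal 0 1) := by
  set f : ℝ → ℝ → ℝ := fun c => (Set.Iic c).indicator fun _ => (1 : ℝ) with hf
  have hfm (c : ℝ) : Measurable (f c) := measurable_const.indicator measurableSet_Iic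
  have hf01 (c x : ℝ) : f c x = 0 ∨ f c x = 1 := by
    by_cases h : x ≤ c <;> simp [hf, h]
  have hfint (c : ℝ) : Integrable (f c) ν := (integrable_const 1).indicator measurableSet_Iic
  have hfmean (c : ℝ) : ∫ x, f c x ∂ν = ν.real (Set.Iic c) := by
    simp [hf, integral_indicator_const _ measurableSet_Iic]
  have hZ i := (hlaw i).aemeasurable
  -- the random signs at the threshold `0` are centred with variance `1`
  have hsign : Measurable fun x => 2 * f 0 x - 1 := ((hfm 0).const_mul 2).sub_const 1
  have hU : TendstoInDistribution
      (fun (n : ℕ) ω => (√n)⁻¹ * ∑ i ∈ Finset.range n, (2 * f 0 (Z i ω) - 1)) atTop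
      (id : ℝ → ℝ) (fun _ => P) (gaussianReal 0 1) := by
    refine tendstoInDistribution_inv_sqrt_mul_sum (X := fun i ω => 2 * f 0 (Z i ω) - 1) .id ?_ ?_
      (hindep.comp (fun _ x => 2 * f 0 x - 1) fun _ => hsign)
      fun i => ((hlaw i).identDistrib (hlaw 0)).comp hsign
    · refine ((hlaw 0).integral_comp hsign.aestronglyMeasurable).trans ?_
      rw [integral_sub ((hfint 0).const_mul 2) (integrable_const 1), integral_const_mul, hfmean, h0]
      simp
    · have h1 (x : ℝ) : (2 * f 0 x - 1) ^ 2 = 1 := by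
        rcases hf01 0 x with h | h <;> rw [h] <;> norm_num
      simp [h1]
  have hD : TendstoInMeasure P (fun (n : ℕ) ω => (√n)⁻¹ * ∑ i ∈ Finset.range n,
      (2 * (f (a n) (Z i ω) - f 0 (Z i ω)) - ∫ x, 2 * (f (a n) x - f 0 x) ∂ν)) atTop 0 := by
    refine tendstoInMeasure_inv_sqrt_mul_sum_sub hindep hlaw
      (g := fun n x => 2 * (f (a n) x - f 0 x)) (C := 2)
      (fun n => ((hfm _).sub (hfm 0)).const_mul 2) (fun n x => ?_) ?_
    · rcases hf01 (a n) x with h | h <;> rcases hf01 0 x with h' | h' <;> rw [h, h'] <;> norm_num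
    · have : Tendsto (fun n => 4 * |ν.real (Set.Iic (a n)) - 1 / 2|) atTop (𝓝 0) := by
        simpa using ((ha.sub_const (1 / 2)).abs.const_mul 4)
      refine this.congr fun n => ?_
      rw [← h0, ← integral_indicator_sub_indicator_sq, ← integral_const_mul]
      refine integral_congr_ae (ae_of_all _ fun x => ?_)
      simp only [hf]
      ring
  have hm : TendstoInMeasure P (fun (n : ℕ) (_ : Ω) => 2 * √n * (ν.real (Set.Iic (a n)) - 1 / 2))
      atTop (fun _ => s) :=
    tendstoInMeasure_of_tendsto_ae (fun _ => aestronglyMeasurable_const)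
      (ae_of_all _ fun _ => hdrift)
  have hDm (n : ℕ) : AEMeasurable (fun ω => (√n)⁻¹ * ∑ i ∈ Finset.range n,
      (2 * (f (a n) (Z i ω) - f 0 (Z i ω)) - ∫ x, 2 * (f (a n) x - f 0 x) ∂ν)) P := by
    refine (Finset.aemeasurable_fun_sum _ fun i _ => ?_).const_mul _
    exact ((((hfm _).comp_aemeasurable (hZ i)).sub
      ((hfm 0).comp_aemeasurable (hZ i))).const_mul 2).sub_const _
  refine ((hU.add_of_tendstoInMeasure_const hD hDm).add_of_tendstoInMeasure_const hm
    fun n => aemeasurable_const).congr (fun n => ae_of_all _ fun ω => ?_)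
    (.of_forall fun x => congrArg (· + s) (add_zero x))
  have hcard : ∑ i ∈ Finset.range n, f (a n) (Z i ω) =
      (Finset.card {i : Fin n | Z i ω ≤ a n} : ℝ) :=
    sum_range_indicator_eq_card (fun i => Z i ω) (· ≤ a n) n
  have hI : ∫ x, 2 * (f (a n) x - f 0 x) ∂ν = 2 * (ν.real (Set.Iic (a n)) - 1 / 2) := by
    rw [integral_const_mul, integral_sub (hfint _) (hfint 0), hfmean, hfmean, h0]
  have hsq : (√n)⁻¹ * (n : ℝ) = √n := by rw [inv_mul_eq_div, Real.div_sqrt]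
  simp only [Pi.add_apply, hI, ← hcard, Finset.sum_sub_distrib, ← Finset.mul_sum,
    Finset.sum_const, Finset.card_range, nsmul_eq_mul]
  linear_combination (2 * (ν.real (Set.Iic (a n)) - 1 / 2)) * (-hsq)

/-- **Asymptotic normality of the sample median**: if the common distribution function `F`
satisfies `F(0) = 1/2` and `F'(0) = c / 2 > 0`, then `c √n · median` converges in distribution to
`N(0, 1)`. The event `median ≤ a` lies between the events that more than half, respectively at least
half, of the observations are at most `a`, and these have the same limiting probability. -/
theorem tendstoInDistribution_sampleMedian [IsProbabilityMeasure ν] (hindep : iIndepFun Z P)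
    (hlaw : ∀ i, HasLaw (Z i) ν P) (h0 : ν.real (Set.Iic 0) = 1 / 2) {c : ℝ} (hc : 0 < c)
    (hderiv : HasDerivAt (fun t => ν.real (Set.Iic t)) (c / 2) 0) :
    TendstoInDistribution (fun (n : ℕ) ω => c * √n * sampleMedian fun i : Fin n => Z i ω) atTop
      (id : ℝ → ℝ) (fun _ => P) (gaussianReal 0 1) := by
  have hmeas (n : ℕ) : AEMeasurable (fun ω => sampleMedian fun i : Fin n => Z i ω) P :=
    (measurable_sampleMedian n).comp_aemeasurable
      (aemeasurable_pi_iff.2 fun i => (hlaw i).aemeasurable)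
  refine ⟨fun n => (hmeas n).const_mul _, aemeasurable_id,
    tendsto_probabilityMeasure_of_tendsto_measureReal_Iic fun s => ?_⟩
  simp only [ProbabilityMeasure.coe_mk, Measure.map_id]
  have hsqrt : Tendsto (fun n : ℕ => √(n : ℝ)) atTop atTop :=
    Real.tendsto_sqrt_atTop.comp tendsto_natCast_atTop_atTop
  set a : ℕ → ℝ := fun n => s / (c * √n) with ha_def
  have ha : Tendsto a atTop (𝓝 0) := tendsto_const_nhds.div_atTop (hsqrt.const_mul_atTop hc)
  have hdrift : Tendsto (fun n : ℕ => 2 * √n * (ν.real (Set.Iic (a n)) - 1 / 2)) atTop (𝓝 s) := by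
    rcases eq_or_ne s 0 with rfl | hs
    · simp [ha_def, h0]
    have hne : ∀ᶠ n : ℕ in atTop, a n ≠ 0 := by
      filter_upwards [hsqrt.eventually_gt_atTop 0] with n hn
      positivity
    have hslope := (hasDerivAt_iff_tendsto_slope.1 hderiv).comp
      (tendsto_nhdsWithin_iff.2 ⟨ha, hne⟩)
    have := hslope.const_mul (2 * s / c)
    rw [show 2 * s / c * (c / 2) = s by field_simp] at this
    refine this.congr' ?_
    filter_upwards [hsqrt.eventually_gt_atTop 0] with n hn
    simp only [Function.comp_apply, slope_def_field, h0, sub_zero, ha_def]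
    field_simp
  have hFa : Tendsto (fun n => ν.real (Set.Iic (a n))) atTop (𝓝 (1 / 2)) := by
    rw [← h0]
    exact hderiv.continuousAt.tendsto.comp ha
  have hV := tendstoInDistribution_card_Iic hindep hlaw h0 hFa hdrift
  -- any set with boundary `{0}` between `Ioi 0` and `Ici 0` has the limiting probability `Φ(s)`
  have hlim {B : Set ℝ} (hB : MeasurableSet B) (hfr : frontier B = {0})
      (hval : (fun x : ℝ => x + s) ⁻¹' B =ᵐ[gaussianReal 0 1] Set.Ici (-s)) :
      Tendsto (fun n : ℕ => P.real {ω | (√n)⁻¹ *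
        (2 * (Finset.card {i : Fin n | Z i ω ≤ a n} : ℝ) - n) ∈ B}) atTop
        (𝓝 ((gaussianReal 0 1).real (Set.Iic s))) := by
    have hms : Measurable fun x : ℝ => x + s := measurable_id.add_const s
    have h := ProbabilityMeasure.tendsto_measure_of_null_frontier_of_tendsto' hV.tendsto
      (E := B) (by
      rw [ProbabilityMeasure.coe_mk, hfr, Measure.map_apply hms (measurableSet_singleton 0)]
      have : (fun x : ℝ => x + s) ⁻¹' {0} = {-s} := by
        ext x
        simp [eq_neg_iff_add_eq_zero]
      rw [this, measure_singleton])
    have := Measure.isProbabilityMeasure_map (μ := gaussianReal 0 1) hms.aemeasurable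
    have h' := (ENNReal.tendsto_toReal
      (measure_ne_top ((gaussianReal 0 1).map fun x => x + s) B)).comp h
    have hlimval : (gaussianReal 0 1).real (Set.Iic s) =
        (((gaussianReal 0 1).map fun x => x + s) B).toReal := by
      rw [← measureReal_def, map_measureReal_apply hms hB, measureReal_congr hval]
      have := gaussianReal_measureReal_Iic_neg s
      rw [← measureReal_congr Ioi_ae_eq_Ici, ← Set.compl_Iic,
        probReal_compl_eq_one_sub measurableSet_Iic, this]
      ring
    rw [hlimval]
    refine h'.congr fun n => ?_
    simp only [Function.comp_apply, ProbabilityMeasure.coe_mk]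
    rw [Measure.map_apply_of_aemeasurable (hV.forall_aemeasurable n) hB]
    rfl
  have hlow := hlim measurableSet_Ioi frontier_Ioi (by
    have : (fun x : ℝ => x + s) ⁻¹' Set.Ioi 0 = Set.Ioi (-s) := by
      ext x
      simp [neg_lt_iff_pos_add]
    rw [this]
    exact Ioi_ae_eq_Ici)
  have hup := hlim measurableSet_Ici frontier_Ici (by
    have : (fun x : ℝ => x + s) ⁻¹' Set.Ici 0 = Set.Ici (-s) := by
      ext x
      simp [neg_le_iff_add_nonneg]
    rw [this]
    exact EventuallyEq.rfl)
  have hmap (n : ℕ) : (P.map fun ω => c * √n * sampleMedian fun i : Fin n => Z i ω).real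
      (Set.Iic s) = P.real {ω | (c * √n * sampleMedian fun i : Fin n => Z i ω) ≤ s} := by
    rw [map_measureReal_apply_of_aemeasurable ((hmeas n).const_mul _) measurableSet_Iic]
    rfl
  simp only [hmap]
  refine tendsto_of_tendsto_of_tendsto_of_le_of_le' hlow hup ?_ ?_
  · filter_upwards [hsqrt.eventually_gt_atTop 0] with n hn
    refine measureReal_mono fun ω hω => ?_
    simp only [Set.mem_ofPred_eq, Set.mem_Ioi] at hω ⊢
    have h1 := pos_of_mul_pos_right hω (inv_nonneg.2 hn.le)
    have h2 : n < 2 * Finset.card {i : Fin n | Z i ω ≤ a n} := by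
      exact_mod_cast (sub_pos.1 h1)
    have h3 := sampleMedian_le_of_lt_card h2
    rwa [ha_def, le_div_iff₀' (by positivity)] at h3
  · filter_upwards [hsqrt.eventually_gt_atTop 0] with n hn
    refine measureReal_mono fun ω hω => ?_
    simp only [Set.mem_ofPred_eq, Set.mem_Ici] at hω ⊢
    have h2 : (n : ℝ) ≤ 2 * Finset.card {i : Fin n | Z i ω ≤ a n} := by
      exact_mod_cast le_card_of_sampleMedian_le ((le_div_iff₀' (by positivity)).2 hω)
    exact mul_nonneg (inv_nonneg.2 hn.le) (sub_nonneg.2 h2)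

end IID

/-! ### The studentized median -/

/-- Convergence in distribution of statistics of i.i.d. samples depends only on the common law:
it passes from the initial segments of one infinite sequence to arbitrary samples. -/
lemma TendstoInDistribution.of_infinitePi {Ω : ℕ → Type*} [∀ n, MeasurableSpace (Ω n)]
    {P : (n : ℕ) → Measure (Ω n)} [∀ n, IsProbabilityMeasure (P n)] {ν ρ : Measure ℝ}
    [IsProbabilityMeasure ν] [IsProbabilityMeasure ρ] {Z : (n : ℕ) → Fin n → Ω n → ℝ}
    (hindep : ∀ n, iIndepFun (Z n) (P n)) (hlaw : ∀ n i, HasLaw (Z n i) ν (P n))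
    {T : (n : ℕ) → (Fin n → ℝ) → ℝ} (hT : ∀ n, Measurable (T n))
    (h : TendstoInDistribution (fun n (ω : ℕ → ℝ) => T n fun i => ω i) atTop (id : ℝ → ℝ)
      (fun _ => Measure.infinitePi fun _ => ν) ρ) :
    TendstoInDistribution (fun n ω => T n fun i => Z n i ω) atTop (id : ℝ → ℝ) P ρ := by
  have hZ (n : ℕ) : AEMeasurable (fun ω i => Z n i ω) (P n) :=
    aemeasurable_pi_iff.2 fun i => (hlaw n i).aemeasurable
  refine ⟨fun n => (hT n).comp_aemeasurable (hZ n), aemeasurable_id, ?_⟩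
  refine h.tendsto.congr fun n => Subtype.ext ?_
  have h1 : (P n).map (fun ω => T n fun i => Z n i ω) =
      (Measure.infinitePi fun _ : Fin n => ν).map (T n) := by
    rw [← ((hindep n).hasLaw_infinitePi (hlaw n) (hZ n)).map_eq,
      AEMeasurable.map_map_of_aemeasurable (hT n).aemeasurable (hZ n)]
    rfl
  have h2 : (Measure.infinitePi fun _ : ℕ => ν).map (fun ω => T n fun i => ω i) =
      (Measure.infinitePi fun _ : Fin n => ν).map (T n) := by
    rw [← Measure.map_infinitePi_infinitePi_of_inj (P := fun _ : ℕ => ν)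
      (Fin.val_injective (n := n)), Measure.map_map (hT n) (by fun_prop)]
    rfl
  exact h2.trans h1.symm

/-- The limit theorem for a single i.i.d. sequence of standard normal variables: Slutsky's theorem
with the factor `Φ⁻¹(3/4) / MAD → 1`. -/
lemma tendstoInDistribution_studentized_median {Ω : Type*} [MeasurableSpace Ω] {P : Measure Ω}
    [IsProbabilityMeasure P] {Z : ℕ → Ω → ℝ} (hindep : iIndepFun Z P)
    (hlaw : ∀ i, HasLaw (Z i) (gaussianReal 0 1) P) :
    TendstoInDistribution (fun (n : ℕ) ω => √(2 * (n : ℝ) / Real.pi) *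
      quantile (gaussianReal 0 1) (3 / 4) *
        (sampleMedian (fun i : Fin n => Z i ω) / sampleMAD fun i : Fin n => Z i ω))
      atTop (id : ℝ → ℝ) (fun _ => P) (gaussianReal 0 1) := by
  have hZ (n : ℕ) : AEMeasurable (fun ω (i : Fin n) => Z i ω) P :=
    aemeasurable_pi_iff.2 fun i => (hlaw i).aemeasurable
  have hq := quantile_gaussianReal_pos
  set q := quantile (gaussianReal 0 1) (3 / 4) with hq_def
  have h0 := gaussianReal_measureReal_Iic_zero
  have hgt (ε : ℝ) (hε : ε > 0) : 1 / 2 < (gaussianReal 0 1).real (Set.Iic ε) :=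
    h0.symm.trans_lt (strictMono_gaussianReal_measureReal_Iic hε)
  have hlt (ε : ℝ) (hε : ε > 0) : (gaussianReal 0 1).real (Set.Iic (-ε)) < 1 / 2 :=
    (strictMono_gaussianReal_measureReal_Iic (neg_lt_zero.2 hε)).trans_eq h0
  have hmad := ae_tendsto_sampleMAD hindep hlaw (ae_tendsto_sampleMedian hindep hlaw hgt hlt)
    (fun r hr => half_lt_gaussianReal_Icc hr) (fun r hr => gaussianReal_Icc_lt_half hr)
  have hratio_meas (n : ℕ) : AEMeasurable (fun ω => q / sampleMAD fun i : Fin n => Z i ω) P :=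
    ((measurable_sampleMAD n).comp_aemeasurable (hZ n)).const_div q
  have hratio : TendstoInMeasure P (fun (n : ℕ) ω => q / sampleMAD fun i : Fin n => Z i ω) atTop
      (fun _ => 1) := by
    refine tendstoInMeasure_of_tendsto_ae (fun n => (hratio_meas n).aestronglyMeasurable) ?_
    filter_upwards [hmad] with ω hω
    rw [← div_self hq.ne']
    exact tendsto_const_nhds.div hω hq.ne'
  have hderiv : HasDerivAt (fun t => (gaussianReal 0 1).real (Set.Iic t))
      (√(2 / Real.pi) / 2) 0 := by
    convert! hasDerivAt_gaussianReal_measureReal_Iic_zero using 1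
    rw [Real.sqrt_div zero_le_two, Real.sqrt_mul zero_le_two]
    field_simp
    rw [Real.sq_sqrt zero_le_two]
  have hmed := tendstoInDistribution_sampleMedian hindep hlaw h0 (by positivity) hderiv
  refine (hmed.continuous_comp_prodMk_of_tendstoInMeasure_const (g := fun x => x.1 * x.2)
    (by fun_prop) hratio hratio_meas).congr (fun n => ae_of_all _ fun ω => ?_)
    (.of_forall fun x => mul_one x)
  have hsqrt : √(2 * (n : ℝ) / Real.pi) = √(2 / Real.pi) * √n := by
    rw [← Real.sqrt_mul (by positivity)]
    ring_nf
  simp only [hsqrt]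
  ring

theorem proposition2 {Ω : ℕ → Type*} [∀ n, MeasurableSpace (Ω n)]
    (P : (n : ℕ) → Measure (Ω n)) [∀ n, IsProbabilityMeasure (P n)]
    (μ : ℝ) (σ : ℝ≥0) (hσ : 0 < σ)
    (X : (n : ℕ) → Fin n → Ω n → ℝ)
    (hindep : ∀ n, iIndepFun (X n) (P n))
    (hlaw : ∀ n i, HasLaw (X n i) (gaussianReal μ (σ ^ 2)) (P n)) :
    TendstoInDistribution
      (fun (n : ℕ) (ω : Ω n) =>
        √(2 * (n : ℝ) / Real.pi) * quantile (gaussianReal 0 1) (3 / 4) *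
          ((sampleMedian (fun i => X n i ω) - μ) / sampleMAD (fun i => X n i ω)))
      atTop (id : ℝ → ℝ) P (gaussianReal 0 1) := by
  have hσ' : (0 : ℝ) < σ := hσ
  -- standardize the observations
  have hstd : Measurable fun x : ℝ => (x - μ) / σ := (measurable_id.sub_const μ).div_const _
  have hZlaw (n : ℕ) (i : Fin n) :
      HasLaw (fun ω => (X n i ω - μ) / σ) (gaussianReal 0 1) (P n) := by
    convert! gaussianReal_div_const (gaussianReal_sub_const (hlaw n i) μ) (σ : ℝ)
    · simp
    · ext
      simp [hσ.ne']
  have hT (n : ℕ) : Measurable fun x : Fin n → ℝ => √(2 * (n : ℝ) / Real.pi) *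
      quantile (gaussianReal 0 1) (3 / 4) * (sampleMedian x / sampleMAD x) :=
    ((measurable_sampleMedian n).div (measurable_sampleMAD n)).const_mul _
  have hZindep := iIndepFun_infinitePi (P := fun _ : ℕ => gaussianReal 0 1)
    (X := fun _ x => x) fun _ => measurable_id
  have hseq := tendstoInDistribution_studentized_median hZindep fun i =>
    ⟨(measurable_pi_apply i).aemeasurable, Measure.infinitePi_map_eval _ i⟩
  refine (TendstoInDistribution.of_infinitePi
    (fun n => (hindep n).comp (fun _ x => (x - μ) / σ) fun _ => hstd) hZlaw hT hseq).congr
    (fun n => ae_of_all _ fun ω => ?_) .rfl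
  rcases Nat.eq_zero_or_pos n with rfl | hn
  · simp
  have hX : (fun i => X n i ω) = fun i => μ + σ * ((X n i ω - μ) / σ) := by
    funext i
    field_simp
    ring
  simp only [Function.comp_def]
  rw [hX, sampleMedian_add_mul hn μ hσ', sampleMAD_add_mul hn μ hσ', add_sub_cancel_left,
    mul_div_mul_left _ _ hσ'.ne']
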